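/- Let $K_n$ be the complete graph on $n$ vertices. For a graph $G$, let $\rho^2_3(G)$ (the plane cover number) be the minimum number of planes in $\mathbb{R}^3$ such that $G$ has a crossing-free straight-line drawing in $\mathbb{R}^3$ that is contained in the union of these planes. Let $c(K_n,K_s)$ be the minimum size of a set of subgraphs of $K_n$, each isomorphic to $K_s$, such that every edge of $K_n$ belongs to at least one of them, with the convention $c(K_n,K_s)=0$ if $s>n$. **Theorem.** For all $n\ge 3$, $$c(K_n,K_4)\;\le\;\rho^2_3(K_n)\;\le\;c(K_n,K_3),$$ and, as $n\to\infty$, $$c(K_n,K_4)=(1+o(1))\,\frac{n^2}{12},\qquad c(K_n,K_3)=(1+o(1))\,\frac{n^2}{6}.$$ Consequently $\rho^2_3(K_n)$ is determined asymptotically up to a factor of $2$: for every $\varepsilon>0$ and all sufficiently large $n$, $$\left(\tfrac1{12}-\varepsilon\right)n^2\le\rho^2_3(K_n)\le\left(\tfrac16+\varepsilon\right)n^2;$$ in particular $\rho^2_3(K_n)=\Theta(n^2)$. -/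

import Mathlib

open Filter Asymptotics

/-- A combinatorial cover of `G` by `s`-cliques: a finite set of subgraphs of `G`, each isomorphic
to the complete graph on `s` vertices, such that every edge of `G` is an edge of one of them. -/
structure IsCliqueCover {V : Type*} (G : SimpleGraph V) (s : ℕ) (C : Finset G.Subgraph) :
    Prop where
  isComplete : ∀ H ∈ C, Nonempty (H.coe ≃g (⊤ : SimpleGraph (Fin s)))
  covers : ∀ e ∈ G.edgeSet, ∃ H ∈ C, e ∈ H.edgeSet

/-- The minimum size of a combinatorial cover of `G` by `s`-cliques. If there is no such cover
(for instance `G` complete on `n` vertices with `2 ≤ n < s`) the value is `0`, by convention. -/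
noncomputable def cliqueCoverNumber {V : Type*} (G : SimpleGraph V) (s : ℕ) : ℕ :=
  sInf {k : ℕ | ∃ C : Finset G.Subgraph, IsCliqueCover G s C ∧ C.card = k}

/-- `c(K_n, K_s)`. -/
noncomputable def completeCoverNumber (n s : ℕ) : ℕ :=
  cliqueCoverNumber (⊤ : SimpleGraph (Fin n)) s

/-- `p` gives the vertex positions of a crossing-free straight-line drawing of `G` in `ℝ^d`:
distinct vertices are distinct points, no edge passes through a vertex other than its ends, and
(the relative interiors of) two different edges are disjoint. -/
structure IsCrossingFreeDrawing {V : Type*} (G : SimpleGraph V) {d : ℕ}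
    (p : V → EuclideanSpace ℝ (Fin d)) : Prop where
  injective : Function.Injective p
  vertex_notMem : ∀ u v w : V, G.Adj u v → w ≠ u → w ≠ v → p w ∉ segment ℝ (p u) (p v)
  edges_disjoint : ∀ u v x y : V, G.Adj u v → G.Adj x y → s(u, v) ≠ s(x, y) →
    Disjoint (openSegment ℝ (p u) (p v)) (openSegment ℝ (p x) (p y))

/-- The set of points of `ℝ^d` occupied by the straight-line drawing of `G` with vertex
positions `p`: all vertices and all edges. -/
def drawingSet {V : Type*} (G : SimpleGraph V) {d : ℕ} (p : V → EuclideanSpace ℝ (Fin d)) :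
    Set (EuclideanSpace ℝ (Fin d)) :=
  {z | (∃ v, z = p v) ∨ ∃ u v, G.Adj u v ∧ z ∈ segment ℝ (p u) (p v)}

/-- The `l`-dimensional affine cover number `ρ^l_d(G)` of `G` in `ℝ^d`: the minimum number of
`l`-dimensional affine subspaces of `ℝ^d` whose union contains some crossing-free straight-line
drawing of `G`. It is `⊤` if there is no such finite family. -/
noncomputable def affineCoverNumber {V : Type*} (l d : ℕ) (G : SimpleGraph V) : ℕ∞ :=
  sInf {k : ℕ∞ | ∃ (p : V → EuclideanSpace ℝ (Fin d))
    (L : Finset (AffineSubspace ℝ (EuclideanSpace ℝ (Fin d)))),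
    IsCrossingFreeDrawing G p ∧
    (∀ P ∈ L, (P : Set (EuclideanSpace ℝ (Fin d))).Nonempty ∧
      Module.finrank ℝ P.direction = l) ∧
    drawingSet G p ⊆ ⋃ P ∈ L, (P : Set (EuclideanSpace ℝ (Fin d))) ∧
    (L.card : ℕ∞) = k}

/-- The plane cover number `ρ^2_3(K_n)` of the complete graph on `n` vertices. -/
noncomputable def planeCoverNumberComplete (n : ℕ) : ℕ∞ :=
  affineCoverNumber 2 3 (⊤ : SimpleGraph (Fin n))

/-! Upper bound: on the moment curve no two edges cross, so the planes spanned by the triangles of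
any `K_3`-cover carry the drawing. Lower bound: a segment inside a finite union of planes has both
ends in one of them, and a plane holds at most four vertices (a drawing of `K_5` in a plane has a
crossing), so the vertex sets cut out by the planes cover all pairs by blocks of size at most 4. The
asymptotics say that pairs can be covered by `s`-blocks almost without waste. Counting pairs bounds
the number of blocks from below (`PairCover.le_mul`); a recursive transversal design bounds it from
above (`PairCover.asymptotic`). The non-planarity of `K_5` is proved by affine dependences and a
parity count (`not_five_in_plane`). -/

/-- The pairs of distinct elements of `V` can be covered by at most `k` blocks of size at
most `s`. -/
def PairCover (V : Type*) (s k : ℕ) : Prop :=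
  ∃ F : Finset (Finset V), F.card ≤ k ∧ (∀ B ∈ F, B.card ≤ s) ∧
    ∀ x y : V, x ≠ y → ∃ B ∈ F, x ∈ B ∧ y ∈ B

/-! ### Covering pairs by small blocks -/

namespace PairCover

/-- Blocks are pulled back and may shrink. Allowing size at most `s` makes this legitimate, so `n`
can be rounded up freely. -/
theorem of_injective {V W : Type*} [Fintype V] {s k : ℕ} {f : V → W}
    (hf : Function.Injective f) (h : PairCover W s k) : PairCover V s k := by
  classical
  obtain ⟨F, hk, hs, hc⟩ := h
  refine ⟨F.image fun B => Finset.univ.filter fun v => f v ∈ B,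
    Finset.card_image_le.trans hk, ?_, ?_⟩
  · intro B hB
    obtain ⟨A, hA, rfl⟩ := Finset.mem_image.1 hB
    refine le_trans ?_ (hs A hA)
    exact Finset.card_le_card_of_injOn f (fun v hv => by simpa using hv) hf.injOn
  · intro x y hxy
    obtain ⟨B, hB, hx, hy⟩ := hc (f x) (f y) (hf.ne hxy)
    exact ⟨_, Finset.mem_image_of_mem _ hB, by simpa using hx, by simpa using hy⟩

theorem trivial (n : ℕ) {s : ℕ} (hs : 2 ≤ s) : PairCover (Fin n) s (n * n) := by
  classical
  refine ⟨Finset.univ.image fun q : Fin n × Fin n => {q.1, q.2}, ?_, ?_, ?_⟩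
  · exact Finset.card_image_le.trans (by simp)
  · intro B hB
    obtain ⟨q, -, rfl⟩ := Finset.mem_image.1 hB
    exact Finset.card_le_two.trans hs
  · intro x y _
    exact ⟨{x, y}, Finset.mem_image.2 ⟨(x, y), by simp⟩, by simp, by simp⟩

/-- Double counting of ordered pairs. -/
theorem le_mul {n s k : ℕ} (h : PairCover (Fin n) s k) : n * (n - 1) ≤ k * (s * (s - 1)) := by
  classical
  obtain ⟨F, hk, hs, hc⟩ := h
  have hsub : (Finset.univ : Finset (Fin n)).offDiag ⊆ F.biUnion fun B => B.offDiag := by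
    rintro ⟨x, y⟩ hxy
    obtain ⟨B, hB, hx, hy⟩ := hc x y (by simpa using hxy)
    simp only [Finset.mem_biUnion, Finset.mem_offDiag]
    exact ⟨B, hB, hx, hy, by simpa using hxy⟩
  calc n * (n - 1) = (Finset.univ : Finset (Fin n)).offDiag.card := by
        simp [Finset.offDiag_card, Nat.mul_sub]
    _ ≤ ∑ B ∈ F, B.offDiag.card := (Finset.card_le_card hsub).trans Finset.card_biUnion_le
    _ ≤ ∑ B ∈ F, s * (s - 1) := by
        refine Finset.sum_le_sum fun B hB => ?_
        have := hs B hB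
        calc B.offDiag.card = B.card * (B.card - 1) := by
              simp [Finset.offDiag_card, Nat.mul_sub]
          _ ≤ s * (s - 1) := Nat.mul_le_mul this (by omega)
    _ = F.card * (s * (s - 1)) := by simp
    _ ≤ k * (s * (s - 1)) := Nat.mul_le_mul_right _ hk

/-- Two points of `Fin s × ZMod m` in different fibres lie on a common line
`{(i, x + i y) | i}`, provided that `m` is coprime to `(s - 1)!`. -/
theorem exists_line {s m : ℕ} (hm : m.Coprime (s - 1).factorial) {i j : Fin s} (hij : i ≠ j)
    (u v : ZMod m) : ∃ x y : ZMod m, x + (i : ℕ) * y = u ∧ x + (j : ℕ) * y = v := by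
  wlog hlt : i < j generalizing i j u v
  · obtain ⟨x, y, h1, h2⟩ := this hij.symm v u (lt_of_le_of_ne (not_lt.1 hlt) hij.symm)
    exact ⟨x, y, h2, h1⟩
  obtain ⟨d, hd⟩ : ∃ d, (j : ℕ) = i + d := ⟨j - i, by have : (i : ℕ) < j := hlt; omega⟩
  have hd0 : 0 < d := by have : (i : ℕ) < j := hlt; omega
  -- The slope must be `(v - u) / (j - i)`; since `0 < j - i ≤ s - 1`, the denominator divides `(s -
  -- 1)!` and is a unit.
  have hds : d ≤ s - 1 := by have := j.2; omega
  have hcop : d.Coprime m :=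
    (Nat.Coprime.coprime_dvd_right (Nat.dvd_factorial hd0 hds) hm).symm
  have hu : (d : ZMod m) * (d : ZMod m)⁻¹ = 1 := ZMod.coe_mul_inv_eq_one d hcop
  refine ⟨u - (i : ℕ) * ((d : ZMod m)⁻¹ * (v - u)), (d : ZMod m)⁻¹ * (v - u), by ring, ?_⟩
  rw [hd]
  push_cast
  linear_combination (v - u) * hu

/-- The transversal design recursion. -/
theorem transversal {s m k : ℕ} [NeZero m] (hm : m.Coprime (s - 1).factorial)
    (h : PairCover (Fin m) s k) : PairCover (Fin (s * m)) s (m * m + s * k) := by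
  classical
  have hcard : Fintype.card (ZMod m) = m := ZMod.card m
  have e : ZMod m ≃ Fin m := Fintype.equivFinOfCardEq hcard
  obtain ⟨F, hk, hs, hc⟩ := h.of_injective e.injective
  have g : Fin (s * m) ≃ Fin s × ZMod m :=
    finProdFinEquiv.symm.trans (Equiv.prodCongr (Equiv.refl _) e.symm)
  refine of_injective (f := g) g.injective ?_
  -- The `m * m` lines handle pairs in different fibres; a copy of `F` in each of the `s` fibres
  -- handles the rest.
  refine ⟨(Finset.univ.image fun q : ZMod m × ZMod m =>
      Finset.univ.image fun i : Fin s => (i, q.1 + (i : ℕ) * q.2)) ∪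
    ((Finset.univ ×ˢ F).image fun q : Fin s × Finset (ZMod m) => q.2.image fun x => (q.1, x)),
    ?_, ?_, ?_⟩
  · refine (Finset.card_union_le _ _).trans (Nat.add_le_add ?_ ?_)
    · exact Finset.card_image_le.trans (by simp [hcard])
    · refine Finset.card_image_le.trans ?_
      rw [Finset.card_product, Finset.card_univ, Fintype.card_fin]
      exact Nat.mul_le_mul_left _ hk
  · intro B hB
    rcases Finset.mem_union.1 hB with hB | hB
    · obtain ⟨q, -, rfl⟩ := Finset.mem_image.1 hB
      exact Finset.card_image_le.trans (by simp)
    · obtain ⟨q, hq, rfl⟩ := Finset.mem_image.1 hB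
      exact Finset.card_image_le.trans (hs _ (Finset.mem_product.1 hq).2)
  · rintro ⟨i, u⟩ ⟨j, v⟩ hne
    by_cases hij : i = j
    · subst hij
      obtain ⟨B, hB, hu, hv⟩ := hc u v (fun h => hne (by rw [h]))
      refine ⟨B.image fun x => (i, x), Finset.mem_union_right _
        (Finset.mem_image.2 ⟨(i, B), by simp [hB], rfl⟩), ?_, ?_⟩
      · exact Finset.mem_image_of_mem _ hu
      · exact Finset.mem_image_of_mem _ hv
    · obtain ⟨x, y, rfl, rfl⟩ := exists_line hm hij u v
      refine ⟨_, Finset.mem_union_left _ (Finset.mem_image_of_mem _ (Finset.mem_univ (x, y))),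
        ?_, ?_⟩
      · exact Finset.mem_image.2 ⟨i, by simp⟩
      · exact Finset.mem_image.2 ⟨j, by simp⟩

/-- Every `n` is at most `s` times a slightly larger number than `n / s` coprime to
`(s - 1)!`. -/
theorem exists_coprime (n : ℕ) {s : ℕ} (hs : 2 ≤ s) :
    ∃ m, 0 < m ∧ m.Coprime (s - 1).factorial ∧ n ≤ s * m ∧
      s * m ≤ n + s * ((s - 1).factorial + 1) := by
  set M := (s - 1).factorial with hM
  have hM0 : 0 < M := Nat.factorial_pos _
  have h1 := Nat.div_add_mod n (s * M)
  have h2 : n % (s * M) < s * M := Nat.mod_lt _ (by positivity)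
  -- Being 1 modulo `M` forces coprimality.
  refine ⟨M * (n / (s * M) + 1) + 1, by positivity, by simp, ?_, ?_⟩
  · nlinarith
  · have h3 := Nat.mul_div_le n (s * M)
    linarith

/-- The estimate behind the transversal design recursion. -/
theorem recursion_bound {s m n k N D α ε b : ℝ} (hs : 2 ≤ s) (hα0 : 0 < α) (hε : 0 < ε)
    (hαs : α * (s * (s - 1)) = 1) (hb : b = 1 + s * (α + ε)) (hm : 0 ≤ m) (hD0 : 0 ≤ D)
    (hN1 : 1 ≤ N) (hnN : N ≤ n) (hNε : (b * (2 * D) + b * D ^ 2 + s * D) * 2 ≤ ε * N)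
    (hsm : s * m ≤ n + s * D) (hk : k ≤ (α + ε) * m ^ 2 + N * m) :
    m * m + s * k ≤ (α + ε) * n ^ 2 + N * n := by
  have hb0 : 0 < b := by rw [hb]; positivity
  have hs0 : 0 < s := by linarith
  have hn0 : 0 ≤ n := by linarith
  have hq : m ^ 2 ≤ n ^ 2 / s ^ 2 + 2 * D * n + D ^ 2 := by
    have h0 : (s * m) ^ 2 ≤ (n + s * D) ^ 2 := by gcongr
    have h1 : m ^ 2 ≤ (n + s * D) ^ 2 / s ^ 2 := by
      rw [le_div_iff₀ (by positivity)]
      linarith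
    have h2 : (n + s * D) ^ 2 / s ^ 2 = n ^ 2 / s ^ 2 + 2 * D * n / s + D ^ 2 := by
      field_simp
      ring
    have h3 : 2 * D * n / s ≤ 2 * D * n := div_le_self (by positivity) (by linarith)
    linarith
  -- `α` is the fixed point of the recursion: `1 + s * α = s ^ 2 * α`. Hence `b = s ^ 2 * α + s *
  -- ε`, and `s ≥ 2` halves the excess `ε`. The freed `ε / 2 * n ^ 2` pays for all rounding terms.
  have hbs : b * (n ^ 2 / s ^ 2) ≤ (α + ε / 2) * n ^ 2 := by
    have h1 : b ≤ (α + ε / 2) * s ^ 2 := by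
      have := mul_nonneg hε.le (mul_nonneg hs0.le (sub_nonneg.2 hs))
      rw [hb]
      linarith
    calc b * (n ^ 2 / s ^ 2) ≤ (α + ε / 2) * s ^ 2 * (n ^ 2 / s ^ 2) := by gcongr
      _ = (α + ε / 2) * n ^ 2 := by field_simp
  have h1 : m * m + s * k ≤ b * m ^ 2 + N * (s * m) := by
    have := mul_le_mul_of_nonneg_left hk hs0.le
    rw [hb]
    linarith
  have h2 := mul_le_mul_of_nonneg_left hq hb0.le
  have h3 := mul_le_mul_of_nonneg_left hsm (zero_le_one.trans hN1)
  have h4 : b * D ^ 2 ≤ b * D ^ 2 * n := le_mul_of_one_le_right (by positivity) (by linarith)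
  have h5 : N * (s * D) ≤ n * (s * D) := by gcongr
  have h6 := mul_le_mul_of_nonneg_right hNε hn0
  have h7 : ε * N * n ≤ ε * n * n := by gcongr
  linarith

/-- Strong induction, passing from `n` to some `m` near `n / s`. The linear term is there for the
base case: below the threshold `N`, the cover by all pairs costs `n * n ≤ N * n`. -/
theorem asymptotic {s : ℕ} (hs : 2 ≤ s) {ε : ℝ} (hε : 0 < ε) :
    ∃ K : ℝ, ∀ n : ℕ, ∃ k : ℕ, PairCover (Fin n) s k ∧
      (k : ℝ) ≤ (1 / (s * (s - 1)) + ε) * n ^ 2 + K * n := by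
  have hs' : (2 : ℝ) ≤ s := by exact_mod_cast hs
  set D : ℕ := (s - 1).factorial + 1 with hD
  set α : ℝ := 1 / (s * (s - 1)) with hα
  have hαs : α * (s * (s - 1)) = 1 := by
    rw [hα]; have : (s : ℝ) - 1 ≠ 0 := by linarith
    field_simp
  have hα0 : 0 < α := by rw [hα]; apply one_div_pos.2; nlinarith
  set b : ℝ := 1 + s * (α + ε) with hb
  have hb0 : 0 < b := by positivity
  obtain ⟨N₁, hN₁⟩ := exists_nat_ge ((b * (2 * D) + b * D ^ 2 + s * D) * 2 / ε)
  -- `N₁` makes `ε * N` beat the rounding errors; `2 * D + 1` ensures `m < n` once `n ≥ N`.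
  set N : ℕ := N₁ + 2 * D + 1 with hN
  have hNε : (b * (2 * D) + b * D ^ 2 + s * D) * 2 ≤ ε * N := by
    have : (N₁ : ℝ) ≤ N := by rw [hN]; push_cast; linarith [Nat.cast_nonneg (α := ℝ) D]
    have := (div_le_iff₀ hε).1 (hN₁.trans this)
    linarith
  refine ⟨N, fun n => ?_⟩
  induction n using Nat.strong_induction_on with
  | _ n ih =>
    by_cases hn : n < N
    · refine ⟨n * n, trivial n hs, ?_⟩
      have : (n : ℝ) ≤ N := by exact_mod_cast hn.le
      push_cast
      nlinarith [show 0 ≤ (α + ε) * (n : ℝ) ^ 2 by positivity,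
        mul_le_mul_of_nonneg_right this (Nat.cast_nonneg (α := ℝ) n)]
    · push Not at hn
      obtain ⟨m, hm0, hmc, hm1, hm2⟩ := exists_coprime n hs
      rw [← hD] at hm2
      have hmn : m < n := by
        by_contra hcon
        push Not at hcon
        have h1 : s * (m - D) ≤ n := by rw [Nat.mul_sub]; omega
        have h2 : 2 * (m - D) ≤ n := (Nat.mul_le_mul_right _ hs).trans h1
        omega
      obtain ⟨k, hk, hkb⟩ := ih m hmn
      have : NeZero m := ⟨hm0.ne'⟩
      refine ⟨m * m + s * k, (hk.transversal hmc).of_injective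
        (Fin.castLE_injective hm1), ?_⟩
      have hN1 : (1 : ℝ) ≤ N := by
        rw [hN]
        push_cast
        linarith [Nat.cast_nonneg (α := ℝ) D, Nat.cast_nonneg (α := ℝ) N₁]
      push_cast
      exact recursion_bound hs' hα0 hε hαs hb (Nat.cast_nonneg m) (Nat.cast_nonneg D) hN1
        (by exact_mod_cast hn) hNε (by exact_mod_cast hm2) hkb

end PairCover

/-! ### From blocks to clique covers, and the asymptotics of `c(K_n, K_s)` -/

theorem isCliqueCover_of_blocks {V : Type*} [Fintype V] {s : ℕ} (F : Finset (Finset V))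
    (hs : ∀ B ∈ F, B.card = s) (hc : ∀ x y : V, x ≠ y → ∃ B ∈ F, x ∈ B ∧ y ∈ B) :
    ∃ C : Finset (⊤ : SimpleGraph V).Subgraph,
      IsCliqueCover (⊤ : SimpleGraph V) s C ∧ C.card ≤ F.card := by
  classical
  refine ⟨F.image fun B : Finset V => (⊤ : (⊤ : SimpleGraph V).Subgraph).induce (B : Set V),
    ⟨?_, ?_⟩, Finset.card_image_le⟩
  · intro H hH
    obtain ⟨B, hB, rfl⟩ := Finset.mem_image.1 hH
    have e : (B : Set V) ≃ Fin s := Fintype.equivFinOfCardEq (by simpa using hs B hB)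
    refine ⟨⟨e, ?_⟩⟩
    rintro ⟨a, ha⟩ ⟨b, hb⟩
    have ha' : a ∈ B := ha
    have hb' : b ∈ B := hb
    have hab : e ⟨a, ha⟩ = e ⟨b, hb⟩ ↔ a = b := e.injective.eq_iff.trans Subtype.mk_eq_mk
    simp only [SimpleGraph.top_adj, SimpleGraph.Subgraph.coe_adj,
      SimpleGraph.Subgraph.induce_adj, SimpleGraph.Subgraph.top_adj, Finset.mem_coe, ha', hb',
      true_and]
    exact not_congr hab
  · intro e he
    induction e with
    | _ x y =>
      obtain ⟨B, hB, hx, hy⟩ := hc x y (by simpa using he)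
      refine ⟨_, Finset.mem_image_of_mem _ hB, ?_⟩
      have : x ≠ y := by simpa using he
      simp [hx, hy, this]

theorem IsCliqueCover.blocks {V : Type*} [Fintype V] {s : ℕ}
    {C : Finset (⊤ : SimpleGraph V).Subgraph} (h : IsCliqueCover (⊤ : SimpleGraph V) s C) :
    ∃ F : Finset (Finset V), F.card ≤ C.card ∧ (∀ B ∈ F, B.card = s) ∧
      ∀ x y : V, x ≠ y → ∃ B ∈ F, x ∈ B ∧ y ∈ B := by
  classical
  refine ⟨C.image fun H => H.verts.toFinset, Finset.card_image_le, ?_, ?_⟩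
  · intro B hB
    obtain ⟨H, hH, rfl⟩ := Finset.mem_image.1 hB
    obtain ⟨e⟩ := h.isComplete H hH
    rw [Set.toFinset_card, Fintype.card_congr e.toEquiv, Fintype.card_fin]
  · intro x y hxy
    obtain ⟨H, hH, he⟩ := h.covers s(x, y) (by simpa using hxy)
    rw [SimpleGraph.Subgraph.mem_edgeSet] at he
    exact ⟨_, Finset.mem_image_of_mem _ hH, by simpa using H.edge_vert he,
      by simpa using H.edge_vert he.symm⟩

/-- Small blocks are padded to exactly `s` elements, which needs `s ≤ n`. -/
theorem PairCover.exists_isCliqueCover {n s k : ℕ} (hsn : s ≤ n)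
    (h : PairCover (Fin n) s k) :
    ∃ C, IsCliqueCover (⊤ : SimpleGraph (Fin n)) s C ∧ C.card ≤ k := by
  classical
  obtain ⟨F, hk, hs, hc⟩ := h
  have hext : ∀ B : Finset (Fin n), ∃ A, B.card ≤ s → B ⊆ A ∧ A.card = s := by
    intro B
    by_cases hB : B.card ≤ s
    · obtain ⟨A, hBA, -, hA⟩ := Finset.exists_subsuperset_card_eq (Finset.subset_univ B) hB
        (by simpa using hsn)
      exact ⟨A, fun _ => ⟨hBA, hA⟩⟩
    · exact ⟨∅, fun h => absurd h hB⟩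
  choose ext hext using hext
  obtain ⟨C, hC, hCF⟩ := isCliqueCover_of_blocks (F.image ext) (s := s)
    (fun B hB => by
      obtain ⟨A, hA, rfl⟩ := Finset.mem_image.1 hB
      exact (hext A (hs A hA)).2)
    (fun x y hxy => by
      obtain ⟨B, hB, hx, hy⟩ := hc x y hxy
      have := (hext B (hs B hB)).1
      exact ⟨_, Finset.mem_image_of_mem _ hB, this hx, this hy⟩)
  exact ⟨C, hC, hCF.trans (Finset.card_image_le.trans hk)⟩

theorem completeCoverNumber_le {n s k : ℕ} (hsn : s ≤ n) (h : PairCover (Fin n) s k) :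
    completeCoverNumber n s ≤ k := by
  obtain ⟨C, hC, hk⟩ := h.exists_isCliqueCover hsn
  refine le_trans ?_ hk
  exact Nat.sInf_le ⟨C, hC, rfl⟩

theorem exists_blocks_completeCoverNumber {n s : ℕ} (hs : 2 ≤ s) (hsn : s ≤ n) :
    ∃ F : Finset (Finset (Fin n)), F.card ≤ completeCoverNumber n s ∧
      (∀ B ∈ F, B.card = s) ∧ ∀ x y : Fin n, x ≠ y → ∃ B ∈ F, x ∈ B ∧ y ∈ B := by
  obtain ⟨C₀, hC₀, -⟩ := (PairCover.trivial n hs).exists_isCliqueCover hsn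
  have hne : {k : ℕ | ∃ C : Finset (⊤ : SimpleGraph (Fin n)).Subgraph,
      IsCliqueCover ⊤ s C ∧ C.card = k}.Nonempty := ⟨_, C₀, hC₀, rfl⟩
  obtain ⟨C, hC, hk⟩ := Nat.sInf_mem hne
  obtain ⟨F, hF, h⟩ := hC.blocks
  exact ⟨F, hF.trans hk.le, h⟩

theorem completeCoverNumber_of_lt {n s : ℕ} (hn : 2 ≤ n) (hns : n < s) :
    completeCoverNumber n s = 0 := by
  refine Nat.sInf_eq_zero.2 (Or.inr ?_)
  rw [Set.eq_empty_iff_forall_notMem]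
  rintro k ⟨C, hC, -⟩
  obtain ⟨F, -, hs, hc⟩ := hC.blocks
  obtain ⟨B, hB, -⟩ := hc ⟨0, by omega⟩ ⟨1, by omega⟩ (by simp)
  have := B.card_le_univ
  rw [hs B hB, Fintype.card_fin] at this
  omega

theorem eventually_completeCoverNumber {s : ℕ} (hs : 2 ≤ s) {ε : ℝ} (hε : 0 < ε) :
    ∀ᶠ n : ℕ in atTop,
      (1 / (s * (s - 1)) - ε) * (n : ℝ) ^ 2 ≤ completeCoverNumber n s ∧
      (completeCoverNumber n s : ℝ) ≤ (1 / (s * (s - 1)) + ε) * (n : ℝ) ^ 2 := by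
  obtain ⟨K, hK⟩ := PairCover.asymptotic hs (half_pos hε)
  have hs' : (2 : ℝ) ≤ s := by exact_mod_cast hs
  have hpos : 0 < (s : ℝ) * (s - 1) := by nlinarith
  filter_upwards [eventually_ge_atTop s,
    tendsto_natCast_atTop_atTop.eventually_ge_atTop (K / (ε / 2)),
    tendsto_natCast_atTop_atTop.eventually_ge_atTop (1 / (s * (s - 1)) / ε : ℝ)]
    with n hn hKn hn2
  constructor
  · obtain ⟨F, hF, hF', hc⟩ := exists_blocks_completeCoverNumber hs hn
    have h : PairCover (Fin n) s (completeCoverNumber n s) :=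
      ⟨F, hF, fun B hB => (hF' B hB).le, hc⟩
    have h1 : (n : ℝ) * (n - 1) ≤ completeCoverNumber n s * (s * (s - 1)) := by
      have := h.le_mul
      rw [← @Nat.cast_le ℝ] at this
      push_cast [Nat.cast_sub (show 1 ≤ n by omega), Nat.cast_sub (show 1 ≤ s by omega)] at this
      exact this
    have h2 : (n : ℝ) * (n - 1) / (s * (s - 1)) ≤ completeCoverNumber n s :=
      (div_le_iff₀ hpos).2 h1
    have h3 := (div_le_iff₀ hε).1 hn2
    have h4 := mul_le_mul_of_nonneg_right h3 (Nat.cast_nonneg (α := ℝ) n)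
    have h5 : (n : ℝ) * (n - 1) / (s * (s - 1)) =
      1 / (s * (s - 1)) * n ^ 2 - 1 / (s * (s - 1)) * n := by ring
    linarith
  · obtain ⟨k, hk, hkb⟩ := hK n
    have h1 : (completeCoverNumber n s : ℝ) ≤ k := by
      exact_mod_cast completeCoverNumber_le hn hk
    have h3 := (div_le_iff₀ (half_pos hε)).1 hKn
    have h4 := mul_le_mul_of_nonneg_right h3 (Nat.cast_nonneg (α := ℝ) n)
    linarith

theorem completeCoverNumber_isEquivalent {s : ℕ} (hs : 2 ≤ s) :
    (fun n : ℕ => (completeCoverNumber n s : ℝ)) ~[atTop]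
      fun n : ℕ => (n : ℝ) ^ 2 / (s * (s - 1)) := by
  have hs' : (2 : ℝ) ≤ s := by exact_mod_cast hs
  have hpos : 0 < (s : ℝ) * (s - 1) := by nlinarith
  refine isLittleO_iff.2 fun c hc => ?_
  filter_upwards [eventually_completeCoverNumber hs (div_pos hc hpos)] with n hn
  have h1 : (1 / (s * (s - 1)) - c / (s * (s - 1))) * (n : ℝ) ^ 2 =
    n ^ 2 / (s * (s - 1)) - c * (n ^ 2 / (s * (s - 1))) := by ring
  have h2 : (1 / (s * (s - 1)) + c / (s * (s - 1))) * (n : ℝ) ^ 2 =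
    n ^ 2 / (s * (s - 1)) + c * (n ^ 2 / (s * (s - 1))) := by ring
  rw [h1, h2] at hn
  rw [Pi.sub_apply, Real.norm_eq_abs, Real.norm_of_nonneg (by positivity), abs_le]
  constructor <;> linarith [hn.1, hn.2]

/-! ### The moment curve and the upper bound -/

/-- The point of the moment curve with parameter `t`. -/
noncomputable def momentPoint (t : ℝ) : EuclideanSpace ℝ (Fin 3) := !₂[t, t ^ 2, t ^ 3]

theorem momentPoint_combination {a b c d u v x y : ℝ}
    (h : a • momentPoint u + b • momentPoint v = c • momentPoint x + d • momentPoint y) :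
    a * u + b * v = c * x + d * y ∧ a * u ^ 2 + b * v ^ 2 = c * x ^ 2 + d * y ^ 2 ∧
      a * u ^ 3 + b * v ^ 3 = c * x ^ 3 + d * y ^ 3 := by
  have h0 := congrArg (fun z : EuclideanSpace ℝ (Fin 3) => z 0) h
  have h1 := congrArg (fun z : EuclideanSpace ℝ (Fin 3) => z 1) h
  have h2 := congrArg (fun z : EuclideanSpace ℝ (Fin 3) => z 2) h
  simp [momentPoint] at h0 h1 h2
  exact ⟨h0, h1, h2⟩

theorem momentPoint_injective : Function.Injective momentPoint := by
  intro t u h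
  simpa [momentPoint] using congrArg (fun z : EuclideanSpace ℝ (Fin 3) => z 0) h

/-- The cubic `(t - v) * (t - x) * (t - y)` is an affine functional on the curve. It vanishes on the
second segment, but on the first its value is a positive multiple of its nonzero value at `u`.
Coincidences among `v`, `x`, `y` are harmless, so edges sharing an end are included. -/
theorem disjoint_openSegment_momentPoint {u v x y : ℝ} (huv : u ≠ v) (hux : u ≠ x)
    (huy : u ≠ y) :
    Disjoint (openSegment ℝ (momentPoint u) (momentPoint v))
      (openSegment ℝ (momentPoint x) (momentPoint y)) := by
  rw [Set.disjoint_left]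
  rintro z ⟨a, b, ha, hb, hab, rfl⟩ ⟨c, d, hc, hd, hcd, h⟩
  obtain ⟨h1, h2, h3⟩ := momentPoint_combination h.symm
  have : a * ((u - v) * ((u - x) * (u - y))) = 0 := by
    linear_combination h3 - (v + x + y) * h2 + (v * x + v * y + x * y) * h1
      - (v * x * y) * (hab - hcd)
  exact mul_ne_zero ha.ne' (mul_ne_zero (sub_ne_zero.2 huv)
    (mul_ne_zero (sub_ne_zero.2 hux) (sub_ne_zero.2 huy))) this

theorem isCrossingFreeDrawing_momentPoint {V : Type*} (G : SimpleGraph V) {t : V → ℝ}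
    (ht : Function.Injective t) : IsCrossingFreeDrawing G fun v => momentPoint (t v) where
  injective := momentPoint_injective.comp ht
  vertex_notMem := by
    rintro u v w - hu hv ⟨a, b, -, -, hab, h⟩
    obtain ⟨h1, h2, -⟩ := momentPoint_combination (c := 1) (d := 0) (y := 0)
      (x := t w) (h.trans (by simp))
    have : (t w - t u) * (t w - t v) = 0 := by
      linear_combination -h2 + (t u + t v) * h1 - (t u * t v) * hab
    exact mul_ne_zero (sub_ne_zero.2 (ht.ne hu)) (sub_ne_zero.2 (ht.ne hv)) this
  edges_disjoint := by
    intro u v x y huv hxy hne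
    have huv' := ht.ne huv.ne
    -- Distinct edges share at most one end, so `u` or `v` avoids both `x` and `y`.
    by_cases hu : u = x ∨ u = y
    · have hv : v ≠ x ∧ v ≠ y := by
        have := huv.ne
        constructor
        · rintro rfl
          rcases hu with rfl | rfl
          · exact this rfl
          · exact hne (Sym2.eq_swap)
        · rintro rfl
          rcases hu with rfl | rfl
          · exact hne rfl
          · exact this rfl
      rw [openSegment_symm]
      exact disjoint_openSegment_momentPoint huv'.symm (ht.ne hv.1) (ht.ne hv.2)
    · push Not at hu
      exact disjoint_openSegment_momentPoint huv' (ht.ne hu.1) (ht.ne hu.2)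

theorem IsCrossingFreeDrawing.not_collinear {V : Type*} {d : ℕ}
    {p : V → EuclideanSpace ℝ (Fin d)} (hp : IsCrossingFreeDrawing (⊤ : SimpleGraph V) p)
    {u v w : V} (huv : u ≠ v) (huw : u ≠ w) (hvw : v ≠ w) :
    ¬ Collinear ℝ {p u, p v, p w} := by
  intro h
  rcases h.wbtw_or_wbtw_or_wbtw with h | h | h
  · exact hp.vertex_notMem u w v huw huv.symm hvw (mem_segment_iff_wbtw.2 h)
  · exact hp.vertex_notMem v u w huv.symm hvw.symm huw.symm (mem_segment_iff_wbtw.2 h)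
  · exact hp.vertex_notMem w v u hvw.symm huw huv (mem_segment_iff_wbtw.2 h)

theorem planeCoverNumberComplete_le {n : ℕ} (hn : 3 ≤ n) :
    planeCoverNumberComplete n ≤ (completeCoverNumber n 3 : ℕ∞) := by
  classical
  obtain ⟨F, hF, hs, hc⟩ := exists_blocks_completeCoverNumber (s := 3) (by norm_num) hn
  set p : Fin n → EuclideanSpace ℝ (Fin 3) := fun v => momentPoint ((v : ℕ) : ℝ) with hpdef
  have hp : IsCrossingFreeDrawing (⊤ : SimpleGraph (Fin n)) p :=
    isCrossingFreeDrawing_momentPoint _ (Nat.cast_injective.comp Fin.val_injective)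
  set L := F.image fun B : Finset (Fin n) => affineSpan ℝ (p '' (B : Set (Fin n))) with hL
  have hmem : ∀ B : Finset (Fin n), ∀ v ∈ B, p v ∈ affineSpan ℝ (p '' (B : Set (Fin n))) :=
    fun B v hv => subset_affineSpan ℝ _ (Set.mem_image_of_mem p hv)
  have hcov : ∀ u v : Fin n, u ≠ v → segment ℝ (p u) (p v) ⊆
      ⋃ P ∈ L, (P : Set (EuclideanSpace ℝ (Fin 3))) := by
    intro u v huv
    obtain ⟨B, hB, hu, hv⟩ := hc u v huv
    exact Set.Subset.trans
      ((AffineSubspace.convex _).segment_subset (hmem B u hu) (hmem B v hv))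
      (Set.subset_biUnion_of_mem (u := fun P : AffineSubspace ℝ (EuclideanSpace ℝ (Fin 3)) =>
        (P : Set (EuclideanSpace ℝ (Fin 3)))) (Finset.mem_image_of_mem _ hB))
  refine le_trans (sInf_le ⟨p, L, hp, ?_, ?_, rfl⟩)
    (by exact_mod_cast Finset.card_image_le.trans hF)
  · intro P hP
    obtain ⟨B, hB, rfl⟩ := Finset.mem_image.1 hP
    obtain ⟨u, v, w, huv, huw, hvw, rfl⟩ := Finset.card_eq_three.1 (hs B hB)
    refine ⟨⟨p u, hmem _ u (by simp)⟩, ?_⟩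
    have hind := affineIndependent_iff_not_collinear_set.2 (hp.not_collinear huv huw hvw)
    rw [direction_affineSpan]
    have himage : p '' (({u, v, w} : Finset (Fin n)) : Set (Fin n)) =
        Set.range ![p u, p v, p w] := by
      ext z
      simp [Set.image_insert_eq]
      tauto
    rw [himage]
    exact hind.finrank_vectorSpan (by simp)
  · rintro z (⟨v, rfl⟩ | ⟨u, v, huv, hz⟩)
    · have : Nontrivial (Fin n) := Fin.nontrivial_iff_two_le.2 (by omega)
      obtain ⟨u, hu⟩ := exists_ne v
      exact hcov v u hu.symm (left_mem_segment ℝ _ _)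
    · exact hcov u v huv hz

/-! ### At most four vertices in a plane -/

/-- A sign tournament on five elements, given by an antisymmetric matrix with nonzero
off-diagonal entries, has a row whose number of positive entries is even. -/
theorem exists_row_even {M : Fin 5 → Fin 5 → ℝ} (hM : ∀ i j, M j i = -M i j)
    (hne : ∀ i j, i ≠ j → M i j ≠ 0) :
    ∃ i, Even (Finset.univ.filter fun j => 0 < M i j).card := by
  -- Each of the ten pairs gives exactly one positive entry, so the row counts add up to 10; five
  -- odd numbers have an odd sum.
  by_contra! hodd
  simp only [Nat.not_even_iff_odd] at hodd
  have h1 : ∀ i j, i ≠ j → (if 0 < M i j then 1 else 0) + (if 0 < M j i then 1 else 0) = 1 := by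
    intro i j hij
    rw [hM i j]
    rcases lt_or_gt_of_ne (hne i j hij) with h | h
    · simp [h, h.le]
    · simp [h, h.le]
  have h2 : ∀ i, (if 0 < M i i then 1 else 0) = 0 := by
    intro i
    have := hM i i
    rw [if_neg (by linarith)]
  simp only [Finset.card_filter, Fin.sum_univ_five, Nat.odd_iff] at hodd
  have a0 := hodd 0
  have a1 := hodd 1
  have a2 := hodd 2
  have a3 := hodd 3
  have a4 := hodd 4
  rw [h2] at a0 a1 a2 a3 a4
  have b01 := h1 0 1 (by decide)
  have b02 := h1 0 2 (by decide)
  have b03 := h1 0 3 (by decide)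
  have b04 := h1 0 4 (by decide)
  have b12 := h1 1 2 (by decide)
  have b13 := h1 1 3 (by decide)
  have b14 := h1 1 4 (by decide)
  have b23 := h1 2 3 (by decide)
  have b24 := h1 2 4 (by decide)
  have b34 := h1 3 4 (by decide)
  omega

/-- An affine dependence with two positive and two negative coefficients is a crossing. -/
theorem crossing_of_dependence {E : Type*} [AddCommGroup E] [Module ℝ E] {a b c d : ℝ}
    {x y z w : E} (ha : 0 < a) (hb : 0 < b) (hc : c < 0) (hd : d < 0)
    (hsum : a + b + c + d = 0) (h : a • x + b • y + c • z + d • w = 0) :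
    ¬ Disjoint (openSegment ℝ x y) (openSegment ℝ z w) := by
  rw [Set.not_disjoint_iff]
  have hab : 0 < a + b := by positivity
  refine ⟨(a / (a + b)) • x + (b / (a + b)) • y,
    ⟨a / (a + b), b / (a + b), by positivity, by positivity, by field_simp, rfl⟩,
    ⟨-c / (a + b), -d / (a + b), div_pos (by linarith) hab, div_pos (by linarith) hab, ?_, ?_⟩⟩
  · field_simp
    linarith
  · have h' : (-c) • z + (-d) • w = a • x + b • y := by
      rw [← sub_eq_zero, ← neg_eq_zero, ← h]
      module
    simp only [div_eq_inv_mul, mul_smul, ← smul_add, h']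

/-- Affine dependences of a finite family of points. -/
def IsAffineDependence {ι E : Type*} [Fintype ι] [AddCommGroup E] [Module ℝ E] (q : ι → E)
    (w : ι → ℝ) : Prop :=
  ∑ i, w i = 0 ∧ ∑ i, w i • q i = 0

/-- Five points of a plane have two linearly independent affine dependences. -/
theorem exists_affineDependences {E : Type*} [AddCommGroup E] [Module ℝ E]
    {P : AffineSubspace ℝ E} (hP : Module.finrank ℝ P.direction = 2) {q : Fin 5 → E}
    (hq : ∀ i, q i ∈ P) :
    ∃ a b : Fin 5 → ℝ, IsAffineDependence q a ∧ IsAffineDependence q b ∧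
      LinearIndependent ℝ ![a, b] := by
  have : Module.Finite ℝ P.direction := Module.finite_of_finrank_pos (by omega)
  let r : Fin 5 → P.direction := fun i =>
    ⟨q i - q 0, AffineSubspace.vsub_mem_direction (hq i) (hq 0)⟩
  let T : (Fin 5 → ℝ) →ₗ[ℝ] ℝ × P.direction :=
    (∑ i, LinearMap.proj i).prod (∑ i, (LinearMap.proj i).smulRight (r i))
  -- `T` maps a 5-dimensional space to a 3-dimensional one, and its kernel consists of affine
  -- dependences.
  have hker : 2 ≤ Module.finrank ℝ (LinearMap.ker T) := by
    have h1 := T.finrank_range_add_finrank_ker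
    have h2 := (LinearMap.range T).finrank_le
    rw [Module.finrank_prod, hP, Module.finrank_self] at h2
    rw [Module.finrank_fin_fun] at h1
    omega
  obtain ⟨f, hf⟩ := exists_linearIndependent_of_le_finrank hker
  have hdep : ∀ w : LinearMap.ker T, IsAffineDependence q w := by
    rintro ⟨w, hw⟩
    rw [LinearMap.mem_ker] at hw
    have h1 : ∑ i, w i = 0 := by
      simpa [T] using congrArg Prod.fst hw
    have h2 : ∑ i, w i • (q i - q 0) = 0 := by
      simpa [T, r] using congrArg (fun z => (z.2 : E)) hw
    refine ⟨h1, ?_⟩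
    simpa [smul_sub, Finset.sum_sub_distrib, ← Finset.sum_smul, h1] using h2
  refine ⟨f 0, f 1, hdep _, hdep _, ?_⟩
  have := hf.map' (LinearMap.ker T).subtype (Submodule.ker_subtype _)
  have hfun : ![(f 0 : Fin 5 → ℝ), f 1] = (LinearMap.ker T).subtype ∘ f := by
    funext i
    fin_cases i <;> rfl
  rwa [hfun]

namespace IsCrossingFreeDrawing

variable {V : Type*} {d : ℕ} {p : V → EuclideanSpace ℝ (Fin d)}

/-- What remains is a dependence among three vertices, which are not collinear. -/
theorem dependence_eq_zero (hp : IsCrossingFreeDrawing (⊤ : SimpleGraph V) p) {f : Fin 5 → V}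
    (hf : Function.Injective f) {w : Fin 5 → ℝ} (hw : IsAffineDependence (fun i => p (f i)) w)
    {i j : Fin 5} (hij : i ≠ j) (hi : w i = 0) (hj : w j = 0) : w = 0 := by
  classical
  have hcard : ((Finset.univ.erase i).erase j).card = 3 := by
    rw [Finset.card_erase_of_mem (by simp [hij.symm]), Finset.card_erase_of_mem (by simp)]
    simp
  obtain ⟨k, l, m, hkl, hkm, hlm, hS⟩ := Finset.card_eq_three.1 hcard
  have hmem : ∀ x, x = i ∨ x = j ∨ x = k ∨ x = l ∨ x = m := by
    intro x
    by_contra! h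
    have : x ∈ (Finset.univ.erase i).erase j := by simp [h.1, h.2.1]
    rw [hS] at this
    simp [h.2.2] at this
  have hsum : ∀ {A : Type} [AddCommMonoid A] (g : Fin 5 → A), g i = 0 → g j = 0 →
      ∑ x, g x = g k + g l + g m := by
    intro A _ g hgi hgj
    rw [← Finset.sum_erase _ hgi, ← Finset.sum_erase _ hgj, hS,
      Finset.sum_insert (by simp [hkl, hkm]),
      Finset.sum_insert (by simp [hlm]), Finset.sum_singleton, add_assoc]
  have h1 := hw.1
  have h2 := hw.2
  rw [hsum w hi hj] at h1
  rw [hsum _ (by simp [hi]) (by simp [hj])] at h2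
  have hind := affineIndependent_iff_not_collinear_set.2
    (hp.not_collinear (hf.ne hkl) (hf.ne hkm) (hf.ne hlm))
  have h3 := (affineIndependent_iff.1 hind) Finset.univ ![w k, w l, w m]
    (by simpa [Fin.sum_univ_three] using h1) (by simpa [Fin.sum_univ_three] using h2)
  funext x
  rcases hmem x with rfl | rfl | rfl | rfl | rfl
  · exact hi
  · exact hj
  · exact h3 0 (Finset.mem_univ _)
  · exact h3 1 (Finset.mem_univ _)
  · exact h3 2 (Finset.mem_univ _)

/-- Of the four nonzero weights, zero or four positive ones contradict the vanishing sum, and two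
against two is a crossing of two edges. -/
theorem odd_card_pos (hp : IsCrossingFreeDrawing (⊤ : SimpleGraph V) p) {f : Fin 5 → V}
    (hf : Function.Injective f) {w : Fin 5 → ℝ} (hw : IsAffineDependence (fun i => p (f i)) w)
    {i : Fin 5} (hi : w i = 0) (hne : ∀ j, i ≠ j → w j ≠ 0) :
    Odd (Finset.univ.filter fun j => 0 < w j).card := by
  classical
  set S := Finset.univ.filter fun j => 0 < w j with hS
  set T := Finset.univ.filter fun j => w j < 0 with hT
  have hST : Disjoint S T := by
    rw [Finset.disjoint_left]
    intro x hx hx'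
    simp only [hS, hT, Finset.mem_filter] at hx hx'
    linarith [hx.2, hx'.2]
  have hiST : i ∉ S ∪ T := by simp [hS, hT, hi]
  have hun : insert i (S ∪ T) = Finset.univ := by
    ext x
    by_cases hx : i = x
    · simp [hx]
    · have := (hne x hx).lt_or_gt
      simp [hS, hT, this.symm]
  have hcard : S.card + T.card = 4 := by
    have := congrArg Finset.card hun
    rw [Finset.card_insert_of_notMem hiST, Finset.card_union_of_disjoint hST] at this
    simpa using this
  have hsum : ∀ {A : Type} [AddCommMonoid A] (g : Fin 5 → A), g i = 0 →
      ∑ x, g x = ∑ x ∈ S, g x + ∑ x ∈ T, g x := by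
    intro A _ g hg
    rw [← hun, Finset.sum_insert hiST, hg, zero_add, Finset.sum_union hST]
  have h1 := hw.1
  have h2 := hw.2
  rw [hsum w hi] at h1
  rw [hsum _ (by simp [hi])] at h2
  have hSpos : ∀ x ∈ S, 0 < w x := fun x hx => (Finset.mem_filter.1 hx).2
  have hTneg : ∀ x ∈ T, w x < 0 := fun x hx => (Finset.mem_filter.1 hx).2
  rw [← Nat.not_even_iff_odd]
  intro heven
  have h024 : S.card = 0 ∨ S.card = 2 ∨ T.card = 0 := by
    obtain ⟨r, hr⟩ := heven
    omega
  rcases h024 with h | h | h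
  · have hT0 : T.Nonempty := Finset.card_pos.1 (by omega)
    rw [Finset.card_eq_zero.1 h, Finset.sum_empty, zero_add] at h1
    linarith [Finset.sum_neg hTneg hT0]
  · obtain ⟨k, l, hkl, hSkl⟩ := Finset.card_eq_two.1 h
    obtain ⟨m, n, hmn, hTmn⟩ := Finset.card_eq_two.1 (show T.card = 2 by omega)
    rw [hSkl, hTmn, Finset.sum_pair hkl, Finset.sum_pair hmn, ← add_assoc] at h1 h2
    have hkS : k ∈ S := by simp [hSkl]
    have hlS : l ∈ S := by simp [hSkl]
    have hmT : m ∈ T := by simp [hTmn]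
    have hnT : n ∈ T := by simp [hTmn]
    refine crossing_of_dependence (hSpos k hkS) (hSpos l hlS) (hTneg m hmT) (hTneg n hnT) h1 h2
      (hp.edges_disjoint _ _ _ _ (hf.ne hkl) (hf.ne hmn) ?_)
    have hkT : k ∉ T := Finset.disjoint_left.1 hST hkS
    intro heq
    rcases Sym2.eq_iff.1 heq with ⟨h, -⟩ | ⟨h, -⟩
    · exact hkT (hf h ▸ hmT)
    · exact hkT (hf h ▸ hnT)
  · have hS0 : S.Nonempty := Finset.card_pos.1 (by omega)
    rw [Finset.card_eq_zero.1 h, Finset.sum_empty, add_zero] at h1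
    linarith [Finset.sum_pos hSpos hS0]

/-- A plane contains at most four vertices of a crossing-free straight-line drawing of a
complete graph. -/
theorem not_five_in_plane (hp : IsCrossingFreeDrawing (⊤ : SimpleGraph V) p)
    {P : AffineSubspace ℝ (EuclideanSpace ℝ (Fin d))}
    (hP : Module.finrank ℝ P.direction = 2) {f : Fin 5 → V} (hf : Function.Injective f) :
    ¬ ∀ i, p (f i) ∈ P := by
  intro hmem
  obtain ⟨a, b, ha, hb, hab⟩ := exists_affineDependences hP hmem
  rw [LinearIndependent.pair_iff] at hab
  have ha0 : a ≠ 0 := fun h => one_ne_zero (hab 1 0 (by simp [h])).1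
  -- The minors of `a`, `b` form an antisymmetric matrix whose row `i` is a dependence vanishing at
  -- `i`. Once no other entry vanishes, every row has an odd number of positive entries, against
  -- `exists_row_even`.
  have hrow : ∀ i, IsAffineDependence (fun j => p (f j)) fun j => a i * b j - a j * b i := by
    intro i
    constructor
    · simp only [Finset.sum_sub_distrib, ← Finset.mul_sum, ← Finset.sum_mul, ha.1, hb.1]
      simp
    · have h1 : ∀ j, (a i * b j - a j * b i) • p (f j) =
          a i • b j • p (f j) - b i • a j • p (f j) := fun j => by module
      simp only [h1, Finset.sum_sub_distrib, ← Finset.smul_sum, ha.2, hb.2]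
      simp
  -- A second zero kills row `i`, so `a i • b = b i • a`, and independence gives `a i = 0`; by
  -- symmetry `a j = 0`, whence `a = 0`.
  have hzero : ∀ i j, i ≠ j → a i * b j - a j * b i = 0 → a i = 0 := by
    intro i j hij h
    have h0 := hp.dependence_eq_zero hf (hrow i) hij (by ring) h
    have := hab (-b i) (a i) (by
      rw [← h0]
      funext x
      simp
      ring)
    exact this.2
  have hne : ∀ i j, i ≠ j → a i * b j - a j * b i ≠ 0 := by
    intro i j hij h
    exact ha0 (hp.dependence_eq_zero hf ha hij (hzero i j hij h)
      (hzero j i hij.symm (by linarith)))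
  obtain ⟨i, hi⟩ := exists_row_even (M := fun i j => a i * b j - a j * b i)
    (fun i j => by ring) hne
  exact Nat.not_even_iff_odd.2
    (hp.odd_card_pos hf (hrow i) (i := i) (by ring) (fun j hij => hne i j hij)) hi

end IsCrossingFreeDrawing

/-! ### The lower bound and the conclusion -/

/-- If a segment is covered by finitely many affine subspaces, one of them contains both its
ends. -/
theorem exists_mem_of_segment_subset {E : Type*} [AddCommGroup E] [Module ℝ E]
    {L : Finset (AffineSubspace ℝ E)} {x y : E}
    (h : segment ℝ x y ⊆ ⋃ P ∈ L, (P : Set E)) : ∃ P ∈ L, x ∈ P ∧ y ∈ P := by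
  by_contra! hcon
  -- Two parameters in `P` would put the whole line in `P`, so each `P` accounts for at most one
  -- point of the infinite interval.
  have hfin : ∀ P ∈ L, {t : ℝ | AffineMap.lineMap x y t ∈ P}.Finite := by
    intro P hP
    refine Set.Subsingleton.finite ?_
    intro t ht u hu
    by_contra htu
    have key : ∀ r : ℝ, AffineMap.lineMap x y r ∈ P := by
      intro r
      have h1 := AffineMap.lineMap_mem ((r - t) / (u - t)) ht hu
      rw [← AffineMap.apply_lineMap] at h1
      convert h1 using 2
      rw [AffineMap.lineMap_apply]
      have : u - t ≠ 0 := sub_ne_zero.2 (Ne.symm htu)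
      simp only [vsub_eq_sub, smul_eq_mul, vadd_eq_add]
      field_simp
      ring
    exact hcon P hP (by simpa using key 0) (by simpa using key 1)
  have hsub : Set.Icc (0 : ℝ) 1 ⊆ ⋃ P ∈ L, {t : ℝ | AffineMap.lineMap x y t ∈ P} := by
    intro t ht
    have := h (segment_eq_image_lineMap ℝ x y ▸ Set.mem_image_of_mem _ ht)
    simpa using this
  exact (Set.Icc_infinite (zero_lt_one' ℝ)) ((L.finite_toSet.biUnion hfin).subset hsub)

theorem le_planeCoverNumberComplete {n : ℕ} (hn : 3 ≤ n) :
    (completeCoverNumber n 4 : ℕ∞) ≤ planeCoverNumberComplete n := by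
  classical
  rcases hn.lt_or_eq with h4 | rfl
  swap
  -- For `n = 3` the left side is 0 by convention.
  · simp [completeCoverNumber_of_lt (n := 3) (s := 4)]
  refine le_sInf ?_
  rintro _ ⟨p, L, hp, hL, hcov, rfl⟩
  refine Nat.cast_le.2 (completeCoverNumber_le h4
    ⟨L.image fun P => Finset.univ.filter fun v => p v ∈ P, Finset.card_image_le, ?_, ?_⟩)
  · intro B hB
    obtain ⟨P, hP, rfl⟩ := Finset.mem_image.1 hB
    by_contra! h
    obtain ⟨S, hS, hS5⟩ := Finset.exists_subset_card_eq (Nat.succ_le_of_lt h)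
    refine hp.not_five_in_plane (hL P hP).2 (f := fun i => S.equivFinOfCardEq hS5 |>.symm i)
      (Subtype.val_injective.comp (Equiv.injective _)) fun i => ?_
    exact (Finset.mem_filter.1 (hS ((S.equivFinOfCardEq hS5).symm i).2)).2
  · intro x y hxy
    obtain ⟨P, hP, hx, hy⟩ := exists_mem_of_segment_subset (L := L)
      (fun z hz => hcov (Or.inr ⟨x, y, hxy, hz⟩))
    exact ⟨_, Finset.mem_image_of_mem _ hP, by simpa using hx, by simpa using hy⟩

theorem eventually_planeCoverNumberComplete {ε : ℝ} (hε : 0 < ε) :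
    ∀ᶠ n : ℕ in atTop,
      planeCoverNumberComplete n ≠ ⊤ ∧
      (1 / 12 - ε) * (n : ℝ) ^ 2 ≤ ((planeCoverNumberComplete n).toNat : ℝ) ∧
      ((planeCoverNumberComplete n).toNat : ℝ) ≤ (1 / 6 + ε) * (n : ℝ) ^ 2 := by
  filter_upwards [eventually_completeCoverNumber (s := 4) (by norm_num) hε,
    eventually_completeCoverNumber (s := 3) (by norm_num) hε, eventually_ge_atTop 3]
    with n h4 h3 hn
  have hlo := le_planeCoverNumberComplete hn
  have hup := planeCoverNumberComplete_le hn
  have htop : planeCoverNumberComplete n ≠ ⊤ := ne_top_of_le_ne_top (ENat.natCast_ne_top _) hup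
  rw [← ENat.natCast_toNat htop, Nat.cast_le] at hlo hup
  have hlo' : (completeCoverNumber n 4 : ℝ) ≤ (planeCoverNumberComplete n).toNat := by
    exact_mod_cast hlo
  have hup' : ((planeCoverNumberComplete n).toNat : ℝ) ≤ completeCoverNumber n 3 := by
    exact_mod_cast hup
  norm_num at h4 h3 ⊢
  exact ⟨htop, h4.1.trans hlo', hup'.trans h3.2⟩

theorem mainTheorem6 :
    (∀ n : ℕ, 3 ≤ n →
      (completeCoverNumber n 4 : ℕ∞) ≤ planeCoverNumberComplete n ∧
      planeCoverNumberComplete n ≤ (completeCoverNumber n 3 : ℕ∞)) ∧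
    (fun n : ℕ => (completeCoverNumber n 4 : ℝ)) ~[atTop] (fun n : ℕ => (n : ℝ) ^ 2 / 12) ∧
    (fun n : ℕ => (completeCoverNumber n 3 : ℝ)) ~[atTop] (fun n : ℕ => (n : ℝ) ^ 2 / 6) ∧
    (∀ ε : ℝ, 0 < ε → ∀ᶠ n : ℕ in atTop,
      planeCoverNumberComplete n ≠ ⊤ ∧
      (1 / 12 - ε) * (n : ℝ) ^ 2 ≤ ((planeCoverNumberComplete n).toNat : ℝ) ∧
      ((planeCoverNumberComplete n).toNat : ℝ) ≤ (1 / 6 + ε) * (n : ℝ) ^ 2) ∧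
    (fun n : ℕ => ((planeCoverNumberComplete n).toNat : ℝ)) =Θ[atTop]
      (fun n : ℕ => (n : ℝ) ^ 2) := by
  refine ⟨fun n hn => ⟨le_planeCoverNumberComplete hn, planeCoverNumberComplete_le hn⟩, ?_, ?_,
    fun ε hε => eventually_planeCoverNumberComplete hε, ?_, ?_⟩
  · have h := completeCoverNumber_isEquivalent (s := 4) (by norm_num)
    norm_num at h
    exact h
  · have h := completeCoverNumber_isEquivalent (s := 3) (by norm_num)
    norm_num at h
    exact h
  · refine IsBigO.of_bound 1 ?_
    filter_upwards [eventually_planeCoverNumberComplete (ε := 1 / 24) (by norm_num)] with n hn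
    rw [Real.norm_of_nonneg (by positivity), Real.norm_of_nonneg (by positivity)]
    linarith [hn.2.2, sq_nonneg (n : ℝ)]
  -- `1 / 12 - 1 / 24 = 1 / 24`.
  · refine IsBigO.of_bound 24 ?_
    filter_upwards [eventually_planeCoverNumberComplete (ε := 1 / 24) (by norm_num)] with n hn
    rw [Real.norm_of_nonneg (by positivity), Real.norm_of_nonneg (by positivity)]
    linarith [hn.2.1]
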